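/- Let $U$ be a compact connected Lie group with Lie algebra $\mathfrak u=T_1U$, let $(\cdot\,|\,\cdot)$ be an $\mathrm{Ad}$-invariant Euclidean scalar product on $\mathfrak u$, let $\theta^L_u(\xi)=u^{-1}.\xi$ and $\theta^R_u(\xi)=\xi.u^{-1}$ be the Maurer--Cartan forms, and let $\chi$ be the left-invariant $3$-form on $U$ with $\chi_1(X,Y,Z)=\tfrac12(X\,|\,[Y,Z])$. A quasi-Hamiltonian $U$-space $(M,\omega,\mu)$ is a manifold $M$ with a smooth $U$-action, a smooth $U$-invariant $2$-form $\omega$ and a smooth map $\mu:M\to U$ such that $\mu(u.x)=u\mu(x)u^{-1}$, $d\omega=-\mu^*\chi$, $\ker\omega_x=\{X^\sharp_x : X\in\mathfrak u,\ \mathrm{Ad}\,\mu(x).X=-X\}$ for all $x\in M$, and $\omega(X^\sharp,\cdot)=\tfrac12\,\mu^*(\theta^L+\theta^R\,|\,X)$ for all $X\in\mathfrak u$, where $X^\sharp_x=\tfrac{d}{dt}|_{t=0}\exp(tX).x$ (the exterior derivative being normalized so that $d\omega(X,Y,Z)$ is the cyclic sum of $X(\omega(Y,Z))-\omega([X,Y],Z)$).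 Let $(M_1,\omega_1,\mu_1)$ and $(M_2,\omega_2,\mu_2)$ be two quasi-Hamiltonian $U$-spaces. Let $\tau$ be an involutive automorphism of the Lie group $U$ whose tangent map $T_1\tau$ is an isometry of $(\mathfrak u,(\cdot\,|\,\cdot))$, and put $\tau^-(u)=\tau(u^{-1})$. For $i=1,2$ let $\beta_i$ be a smooth involution on $M_i$ ($\beta_i\circ\beta_i=\mathrm{Id}$) such that (i) $\beta_i^*\omega_i=-\omega_i$; (ii) $\beta_i(u.x)=\tau(u).\beta_i(x)$ for all $u\in U$ and $x\in M_i$; (iii) $\mu_i\circ\beta_i=\tau^-\circ\mu_i$. Endow $M=M_1\times M_2$ with the diagonal action of $U$, the map $\mu(x_1,x_2)=\mu_1(x_1)\mu_2(x_2)$ and the fusion form $\omega=(\omega_1\oplus\omega_2)+(\mu_1^*\theta^L\wedge\mu_2^*\theta^R)$, where $$(\mu_1^*\theta^L\wedge\mu_2^*\theta^R)\big((v_1,v_2),(w_1,w_2)\big)=\tfrac12\Big(\big(\mu_1^*\theta^L(v_1)\,|\,\mu_2^*\theta^R(w_2)\big)-\big(\mu_1^*\theta^L(w_1)\,|\,\mu_2^*\theta^R(v_2)\big)\Big).$$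 Then the map $\beta:M\to M$, $$\beta(x_1,x_2)=\big(\mu_2(\beta_2(x_2)).\beta_1(x_1),\ \beta_2(x_2)\big),$$ is a smooth involution on $M$ such that (i) $\beta^*\omega=-\omega$; (ii) $\beta(u.x)=\tau(u).\beta(x)$ for all $u\in U$ and $x\in M$; (iii) $\mu\circ\beta=\tau^-\circ\mu$. -/

import Mathlib

open Set
open scoped Manifold ContDiff

noncomputable section

namespace QuasiHam

section Forms

variable {E : Type*} [NormedAddCommGroup E] [NormedSpace ℝ E]
  {H : Type*} [TopologicalSpace H] (I : ModelWithCorners ℝ E H)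
  {E' : Type*} [NormedAddCommGroup E'] [NormedSpace ℝ E']
  {H' : Type*} [TopologicalSpace H'] (I' : ModelWithCorners ℝ E' H')
  {M : Type*} [TopologicalSpace M] [ChartedSpace H M]
  {N : Type*} [TopologicalSpace N] [ChartedSpace H' N]

/-- A (not necessarily smooth) real differential `k`-form on the manifold `M`. -/
abbrev DiffForm (M : Type*) [TopologicalSpace M] [ChartedSpace H M] (k : ℕ) : Type _ :=
  ∀ x : M, TangentSpace I x [⋀^Fin k]→L[ℝ] ℝ

/-- The pull-back `f^* Ω` of a differential form `Ω` along `f : M → N`. -/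
def pullback {k : ℕ} (f : M → N) (Ω : DiffForm I' N k) : DiffForm I M k :=
  fun x => (Ω (f x)).compContinuousLinearMap (mfderiv I I' f x)

/-- The expression of a differential form in the chart around `x₀`: its pull-back under the
inverse of that chart, a form on the chart's image in the model space. -/
def inChart {k : ℕ} (Ω : DiffForm I M k) (x₀ : M) : E → E [⋀^Fin k]→L[ℝ] ℝ :=
  fun y => (Ω ((extChartAt I x₀).symm y)).compContinuousLinearMap
    (mfderivWithin 𝓘(ℝ, E) I (extChartAt I x₀).symm (range I) y)

/-- A differential form is smooth if its expressions in the charts are. -/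
def IsSmoothForm {k : ℕ} (Ω : DiffForm I M k) : Prop :=
  ∀ x₀ : M, ContDiffOn ℝ ∞ (inChart I Ω x₀) (extChartAt I x₀).target

/-- The exterior derivative of a differential form, computed at `x` in the chart around `x`,
with the normalization
`dΩ(X₀, …, Xₖ) = ∑ (-1)^i Xᵢ(Ω(…, X̂ᵢ, …)) + ∑_{i<j} (-1)^(i+j) Ω([Xᵢ, Xⱼ], …)`. -/
def extD {k : ℕ} (Ω : DiffForm I M k) : DiffForm I M (k + 1) :=
  fun x => (extDerivWithin (inChart I Ω x) (range I) (extChartAt I x x)).compContinuousLinearMap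
    (mfderiv I 𝓘(ℝ, E) (extChartAt I x) x)

end Forms

section Wedge

variable {V : Type*} [AddCommGroup V] [Module ℝ V] [TopologicalSpace V]
  {W : Type*} [NormedAddCommGroup W] [NormedSpace ℝ W]

/-- The alternating form `(v, w) ↦ ½ (B (a v) (c w) - B (a w) (c v))`. -/
def wedgePairing (B : W →L[ℝ] W →L[ℝ] ℝ) (a c : V →L[ℝ] W) : V [⋀^Fin 2]→L[ℝ] ℝ where
  toFun v := (1 / 2 : ℝ) * (B (a (v 0)) (c (v 1)) - B (a (v 1)) (c (v 0)))
  map_update_add' := by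
    intro _ v i x y
    fin_cases i <;> simp [Function.update] <;> ring
  map_update_smul' := by
    intro _ v i r x
    fin_cases i <;> simp [Function.update] <;> ring
  map_eq_zero_of_eq' := by
    intro v i j hv hij
    fin_cases i <;> fin_cases j <;> simp_all
  cont := by fun_prop

end Wedge

section LieGroups

variable {E : Type*} [NormedAddCommGroup E] [NormedSpace ℝ E]
  {H : Type*} [TopologicalSpace H] (I : ModelWithCorners ℝ E H)
  {U : Type*} [TopologicalSpace U] [ChartedSpace H U] [Group U]

/-- The left-invariant Maurer-Cartan form: `θ^L_u(ξ) = u⁻¹ . ξ`. -/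
def thetaL (u : U) : TangentSpace I u →L[ℝ] GroupLieAlgebra I U :=
  mfderiv I I (fun h : U => u⁻¹ * h) u

/-- The right-invariant Maurer-Cartan form: `θ^R_u(ξ) = ξ . u⁻¹`. -/
def thetaR (u : U) : TangentSpace I u →L[ℝ] GroupLieAlgebra I U :=
  mfderiv I I (fun h : U => h * u⁻¹) u

/-- The adjoint action of `u` on the Lie algebra: the tangent map at `1` of conjugation by `u`. -/
def Ad (u : U) : GroupLieAlgebra I U →L[ℝ] GroupLieAlgebra I U :=
  mfderiv I I (fun h : U => u * h * u⁻¹) 1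

/-- The tangent map at `1` of a group automorphism, an endomorphism of the Lie algebra. -/
def tangentOne (τ : U ≃* U) : GroupLieAlgebra I U →L[ℝ] GroupLieAlgebra I U :=
  mfderiv I I (fun h : U => τ h) 1

/-- `B` is an `Ad`-invariant Euclidean scalar product on the Lie algebra of `U`. -/
structure IsAdInvariantEuclidean
    (B : GroupLieAlgebra I U →L[ℝ] GroupLieAlgebra I U →L[ℝ] ℝ) : Prop where
  symm : ∀ X Y, B X Y = B Y X
  pos : ∀ X, X ≠ 0 → 0 < B X X
  ad_invariant : ∀ (u : U) (X Y), B (Ad I u X) (Ad I u Y) = B X Y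

/-- `τ` is an involutive automorphism of the Lie group `U` endowed with the scalar product `B` on
its Lie algebra, i.e. an involutive smooth automorphism whose tangent map at `1` is an isometry. -/
structure IsInvolutiveAutomorphism
    (B : GroupLieAlgebra I U →L[ℝ] GroupLieAlgebra I U →L[ℝ] ℝ) (τ : U ≃* U) : Prop where
  smooth : ContMDiff I I ∞ (fun u : U => τ u)
  involutive : ∀ u, τ (τ u) = u
  isometry : ∀ X Y, B (tangentOne I τ X) (tangentOne I τ Y) = B X Y

/-- Half the Cartan `3`-form of `U`: the left-invariant form with
`χ_1(X, Y, Z) = ½ (X | [Y, Z])`. -/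
def cartan (B : GroupLieAlgebra I U →L[ℝ] GroupLieAlgebra I U →L[ℝ] ℝ)
    (u : U) (ξ η ζ : TangentSpace I u) : ℝ :=
  (1 / 2 : ℝ) * B (thetaL I u ξ) ⁅thetaL I u η, thetaL I u ζ⁆

end LieGroups

section QHam

variable {E : Type*} [NormedAddCommGroup E] [NormedSpace ℝ E]
  {H : Type*} [TopologicalSpace H] (I : ModelWithCorners ℝ E H)
  {U : Type*} [TopologicalSpace U] [ChartedSpace H U] [Group U]
  {F : Type*} [NormedAddCommGroup F] [NormedSpace ℝ F]
  {K : Type*} [TopologicalSpace K] (J : ModelWithCorners ℝ F K)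
  {M : Type*} [TopologicalSpace M] [ChartedSpace K M] [MulAction U M]

/-- The value at `x` of the fundamental vector field of `X`, i.e. `d/dt|_{t=0} (exp(tX) . x)`,
written as the tangent map at `1` of the orbit map `u ↦ u . x` applied to `X`. -/
def fundamentalField (x : M) : GroupLieAlgebra I U →L[ℝ] TangentSpace J x :=
  mfderiv I J (fun u : U => u • x) 1

/-- `(M, Ω, μ)` is a quasi-Hamiltonian `U`-space. -/
structure IsQuasiHamiltonian (B : GroupLieAlgebra I U →L[ℝ] GroupLieAlgebra I U →L[ℝ] ℝ)
    (Ω : DiffForm J M 2) (μ : M → U) : Prop where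
  smooth_form : IsSmoothForm J Ω
  smooth_momentum : ContMDiff J I ∞ μ
  invariant : ∀ u : U, pullback J J (fun x : M => u • x) Ω = Ω
  equivariant : ∀ (u : U) (x : M), μ (u • x) = u * μ x * u⁻¹
  extD_form : ∀ (x : M) (v₀ v₁ v₂ : TangentSpace J x),
    extD J Ω x ![v₀, v₁, v₂] =
      -cartan I B (μ x) (mfderiv J I μ x v₀) (mfderiv J I μ x v₁) (mfderiv J I μ x v₂)
  ker_form : ∀ x : M, {v : TangentSpace J x | ∀ w : TangentSpace J x, Ω x ![v, w] = 0} =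
    {v | ∃ X : GroupLieAlgebra I U, Ad I (μ x) X = -X ∧ v = fundamentalField I J x X}
  momentum : ∀ (X : GroupLieAlgebra I U) (x : M) (v : TangentSpace J x),
    Ω x ![fundamentalField I J x X, v] =
      (1 / 2 : ℝ) * B (thetaL I (μ x) (mfderiv J I μ x v) + thetaR I (μ x) (mfderiv J I μ x v)) X

/-- `β` is a (smooth) involution of `M` which reverses the `2`-form `Ω` and is compatible, with
respect to `τ`, with the action of `U` and with the momentum map `μ`
(where `τ⁻(u) = τ(u⁻¹)`). -/
structure IsReversingInvolution (τ : U ≃* U) (Ω : DiffForm J M 2) (μ : M → U) (β : M → M) :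
    Prop where
  smooth : ContMDiff J J ∞ β
  involutive : ∀ x, β (β x) = x
  reverses : pullback J J β Ω = -Ω
  action : ∀ (u : U) (x : M), β (u • x) = τ u • β x
  momentum : ∀ x, μ (β x) = τ ((μ x)⁻¹)

end QHam

section Fusion

variable {E : Type*} [NormedAddCommGroup E] [NormedSpace ℝ E]
  {H : Type*} [TopologicalSpace H] (I : ModelWithCorners ℝ E H)
  {U : Type*} [TopologicalSpace U] [ChartedSpace H U] [Group U]
  {F₁ : Type*} [NormedAddCommGroup F₁] [NormedSpace ℝ F₁]
  {K₁ : Type*} [TopologicalSpace K₁] (J₁ : ModelWithCorners ℝ F₁ K₁)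
  {M₁ : Type*} [TopologicalSpace M₁] [ChartedSpace K₁ M₁]
  {F₂ : Type*} [NormedAddCommGroup F₂] [NormedSpace ℝ F₂]
  {K₂ : Type*} [TopologicalSpace K₂] (J₂ : ModelWithCorners ℝ F₂ K₂)
  {M₂ : Type*} [TopologicalSpace M₂] [ChartedSpace K₂ M₂]

/-- The fusion form `(Ω₁ ⊕ Ω₂) + (μ₁^* θ^L ∧ μ₂^* θ^R)` on `M₁ × M₂`. -/
def fusionForm (B : GroupLieAlgebra I U →L[ℝ] GroupLieAlgebra I U →L[ℝ] ℝ)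
    (Ω₁ : DiffForm J₁ M₁ 2) (μ₁ : M₁ → U) (Ω₂ : DiffForm J₂ M₂ 2) (μ₂ : M₂ → U) :
    DiffForm (J₁.prod J₂) (M₁ × M₂) 2 :=
  fun p => pullback (J₁.prod J₂) J₁ Prod.fst Ω₁ p + pullback (J₁.prod J₂) J₂ Prod.snd Ω₂ p +
    wedgePairing (W := E) B
      ((thetaL I (μ₁ p.1)).comp
        ((mfderiv J₁ I μ₁ p.1).comp (mfderiv (J₁.prod J₂) J₁ Prod.fst p)))
      ((thetaR I (μ₂ p.2)).comp
        ((mfderiv J₂ I μ₂ p.2).comp (mfderiv (J₁.prod J₂) J₂ Prod.snd p)))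

/-- The momentum map `μ₁ · μ₂` of the fusion product. -/
def fusionMomentum (μ₁ : M₁ → U) (μ₂ : M₂ → U) : M₁ × M₂ → U :=
  fun p => μ₁ p.1 * μ₂ p.2

/-- The map `(x₁, x₂) ↦ ((μ₂ ∘ β₂(x₂)) . β₁(x₁), β₂(x₂))`. -/
def fusionInvolution [MulAction U M₁] (μ₂ : M₂ → U) (β₁ : M₁ → M₁) (β₂ : M₂ → M₂) :
    M₁ × M₂ → M₁ × M₂ :=
  fun p => (μ₂ (β₂ p.2) • β₁ p.1, β₂ p.2)

end Fusion

end QuasiHam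

end

/-! Everything except the reversal of the fusion form is algebra with equivariance and the momentum
relations. For the reversal, fix `(x₁, x₂)` and put `g = μ₂ (β₂ x₂)`. Near this point the involution
is `g` acting on `(g⁻¹ μ₂ (β₂ z₂)) • β₁ z₁`, where the group factor passes through `1`. Hence the
first component of the image of `(v₁, v₂)` is the `g`-translate of `X^♯ + dβ₁ v₁`, where `X` is `(μ₂
∘ β₂)^* θ^L` at `v₂` (`tmap_fusionInvolution`).

The translation by `g` disappears: `Ω₁` is invariant, and in the fusion term both `μ₁^* θ^L` and
`θ^R = Ad g θ^L` acquire the same `Ad g`, which `B` does not see. What the orbit directions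
contribute is computed by the momentum condition: they turn the `θ^L` of `μ₁` in the fusion term
into `θ^R` and flip the sign (`formAt_add_orbit`).

Finally `τ⁻` reverses products, so pulling back by `βᵢ` exchanges `θ^L` and `θ^R` up to `-dτ`
(`leftLog_tmap`, `rightLog_tmap`). Since `dτ` is an isometry, the original fusion term reappears
with the opposite sign. -/

noncomputable section

namespace QuasiHam

/-! ### Tangent maps between fixed model spaces. -/

section TangentMap

variable {E : Type*} [NormedAddCommGroup E] [NormedSpace ℝ E]
  {H : Type*} [TopologicalSpace H] (I : ModelWithCorners ℝ E H)
  {E' : Type*} [NormedAddCommGroup E'] [NormedSpace ℝ E']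
  {H' : Type*} [TopologicalSpace H'] (I' : ModelWithCorners ℝ E' H')
  {E'' : Type*} [NormedAddCommGroup E''] [NormedSpace ℝ E'']
  {H'' : Type*} [TopologicalSpace H''] (I'' : ModelWithCorners ℝ E'' H'')
  {N : Type*} [TopologicalSpace N] [ChartedSpace H' N]
  {P : Type*} [TopologicalSpace P] [ChartedSpace H'' P]
  {M : Type*} [TopologicalSpace M] [ChartedSpace H M]

/-- The tangent map `mfderiv I I' f x`, regarded as a map between the model spaces, so that the
types do not depend on the base points. -/
def tmap (f : M → N) (x : M) : E →L[ℝ] E' := mfderiv I I' f x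

variable {I I' I''}

/-- The chain rule with the base point `y` kept free, so that `f x` may be replaced by a simpler
equal point, typically `1`. -/
theorem tmap_comp {g : N → P} {f : M → N} {x : M} {y : N}
    (hg : MDifferentiableAt I' I'' g y) (hf : MDifferentiableAt I I' f x) (hy : f x = y) :
    tmap I I'' (fun z => g (f z)) x = (tmap I' I'' g y).comp (tmap I I' f x) := by
  subst hy
  exact mfderiv_comp x hg hf

theorem tmap_comp_apply {g : N → P} {f : M → N} {x : M} {y : N}
    (hg : MDifferentiableAt I' I'' g y) (hf : MDifferentiableAt I I' f x) (hy : f x = y) (v : E) :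
    tmap I I'' (fun z => g (f z)) x v = tmap I' I'' g y (tmap I I' f x v) := by
  rw [tmap_comp hg hf hy]; rfl

theorem tmap_const (c : N) (x : M) : tmap I I' (fun _ : M => c) x = 0 := mfderiv_const

theorem tmap_id (x : M) : tmap I I (fun y : M => y) x = ContinuousLinearMap.id ℝ E := mfderiv_id

theorem tmap_fst (p : M × N) :
    tmap (I.prod I') I (Prod.fst : M × N → M) p = ContinuousLinearMap.fst ℝ E E' := mfderiv_fst

theorem tmap_snd (p : M × N) :
    tmap (I.prod I') I' (Prod.snd : M × N → N) p = ContinuousLinearMap.snd ℝ E E' := mfderiv_snd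

theorem tmap_prodMk {f : P → M} {g : P → N} {x : P} (hf : MDifferentiableAt I'' I f x)
    (hg : MDifferentiableAt I'' I' g x) :
    tmap I'' (I.prod I') (fun z => (f z, g z)) x = (tmap I'' I f x).prod (tmap I'' I' g x) :=
  mfderiv_prodMk hf hg

/-- The tangent map of a map on a product is the sum of the partial tangent maps. -/
theorem tmap_prod_apply {f : M × N → P} {p : M × N} (hf : MDifferentiableAt (I.prod I') I'' f p)
    (v : E × E') :
    tmap (I.prod I') I'' f p v = tmap I I'' (fun z => f (z, p.2)) p.1 v.1 +
      tmap I' I'' (fun z => f (p.1, z)) p.2 v.2 :=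
  mfderiv_prod_eq_add_apply hf

end TangentMap

/-! ### Product rules at the identity of the group. -/

section Action

variable {E : Type*} [NormedAddCommGroup E] [NormedSpace ℝ E]
  {H : Type*} [TopologicalSpace H] {I : ModelWithCorners ℝ E H}
  {U : Type*} [TopologicalSpace U] [ChartedSpace H U] [Group U]
  {F : Type*} [NormedAddCommGroup F] [NormedSpace ℝ F]
  {K : Type*} [TopologicalSpace K] {J : ModelWithCorners ℝ F K}
  {M : Type*} [TopologicalSpace M] [ChartedSpace K M]
  {F' : Type*} [NormedAddCommGroup F'] [NormedSpace ℝ F']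
  {K' : Type*} [TopologicalSpace K'] {J' : ModelWithCorners ℝ F' K'}
  {N : Type*} [TopologicalSpace N] [ChartedSpace K' N]

/-- Because `f x = 1`, the partial map in the second variable is the identity, so the Leibniz rule
carries no translation. -/
theorem tmap_smul_apply_of_eq_one [MulAction U N] [ContMDiffSMul I J' ∞ U N] {f : M → U}
    {h : M → N} {x : M} {y : N} (hf : MDifferentiableAt J I f x) (hh : MDifferentiableAt J J' h x)
    (hf1 : f x = 1) (hy : h x = y) (v : F) :
    tmap J J' (fun z => f z • h z) x v =
      tmap I J' (fun u : U => u • y) 1 (tmap J I f x v) + tmap J J' h x v := by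
  have hs : MDifferentiableAt (I.prod J') J' (fun p : U × N => p.1 • p.2) (1, y) :=
    (contMDiff_smul (n := ∞)).mdifferentiableAt (by simp)
  rw [tmap_comp_apply (I' := I.prod J') (g := fun p : U × N => p.1 • p.2) hs
    (hf.prodMk hh) (by simp [hf1, hy]), tmap_prod_apply hs, tmap_prodMk hf hh]
  simp [tmap_id]

variable [LieGroup I ∞ U]

theorem tmap_mul_apply_of_eq_one {f h : M → U} {x : M} (hf : MDifferentiableAt J I f x)
    (hh : MDifferentiableAt J I h x) (hf1 : f x = 1) (hh1 : h x = 1) (v : F) :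
    tmap J I (fun z => f z * h z) x v = tmap J I f x v + tmap J I h x v := by
  have hs : MDifferentiableAt (I.prod I) I (fun p : U × U => p.1 * p.2) (1, 1) :=
    (contMDiff_mul I ∞).mdifferentiableAt (by simp)
  rw [tmap_comp_apply (I' := I.prod I) (g := fun p : U × U => p.1 * p.2) hs
    (hf.prodMk hh) (by simp [hf1, hh1]), tmap_prod_apply hs, tmap_prodMk hf hh]
  simp [tmap_id]

/-- Differentiate `f * f⁻¹ = 1` with the product rule at the identity. -/
theorem tmap_inv_apply_of_eq_one {f : M → U} {x : M} (hf : MDifferentiableAt J I f x)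
    (hf1 : f x = 1) (v : F) :
    tmap J I (fun z => (f z)⁻¹) x v = -tmap J I f x v := by
  have hi : MDifferentiableAt J I (fun z => (f z)⁻¹) x :=
    ((contMDiff_inv I ∞).mdifferentiableAt (by simp)).comp x hf
  have h := tmap_mul_apply_of_eq_one hf hi hf1 (by simp [hf1]) v
  simp only [mul_inv_cancel, tmap_const] at h
  exact eq_neg_of_add_eq_zero_right h.symm

end Action

/-! ### Pulled-back Maurer–Cartan forms as derivatives of maps passing through `1`. -/

section LogarithmicDerivatives

variable {E : Type*} [NormedAddCommGroup E] [NormedSpace ℝ E]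
  {H : Type*} [TopologicalSpace H] (I : ModelWithCorners ℝ E H)
  {U : Type*} [TopologicalSpace U] [ChartedSpace H U] [Group U]
  {F : Type*} [NormedAddCommGroup F] [NormedSpace ℝ F]
  {K : Type*} [TopologicalSpace K] (J : ModelWithCorners ℝ F K)
  {F' : Type*} [NormedAddCommGroup F'] [NormedSpace ℝ F']
  {K' : Type*} [TopologicalSpace K'] (J' : ModelWithCorners ℝ F' K')
  {N : Type*} [TopologicalSpace N] [ChartedSpace K' N]
  {M : Type*} [TopologicalSpace M] [ChartedSpace K M]

/-- The adjoint action, regarded as a map of the model space. -/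
def adMap (u : U) : E →L[ℝ] E := tmap I I (fun h : U => u * h * u⁻¹) 1

/-- The left logarithmic derivative `f^* θ^L` of a map `f` into a Lie group. -/
def leftLog (f : M → U) (x : M) : F →L[ℝ] E := tmap J I (fun z => (f x)⁻¹ * f z) x

/-- The right logarithmic derivative `f^* θ^R` of a map `f` into a Lie group. -/
def rightLog (f : M → U) (x : M) : F →L[ℝ] E := tmap J I (fun z => f z * (f x)⁻¹) x

variable {I J J'} [LieGroup I ∞ U]

theorem mdifferentiableAt_mul_left (a : U) (x : U) :
    MDifferentiableAt I I (fun h : U => a * h) x :=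
  (contMDiff_mul_left (I := I) (n := ∞)).mdifferentiableAt (by simp)

theorem mdifferentiableAt_mul_right (a : U) (x : U) :
    MDifferentiableAt I I (fun h : U => h * a) x :=
  (contMDiff_mul_right (I := I) (n := ∞)).mdifferentiableAt (by simp)

theorem mdifferentiableAt_conj (a : U) (x : U) :
    MDifferentiableAt I I (fun h : U => a * h * a⁻¹) x :=
  MDifferentiableAt.comp x (mdifferentiableAt_mul_right a⁻¹ _) (mdifferentiableAt_mul_left a x)

theorem mdifferentiableAt_inv (x : U) : MDifferentiableAt I I (fun h : U => h⁻¹) x :=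
  (contMDiff_inv I ∞).mdifferentiableAt (by simp)

theorem thetaL_mfderiv {f : M → U} {x : M} (hf : MDifferentiableAt J I f x) (v : F) :
    thetaL I (f x) (mfderiv J I f x v) = leftLog I J f x v :=
  (tmap_comp_apply (mdifferentiableAt_mul_left (f x)⁻¹ (f x)) hf rfl v).symm

theorem thetaR_mfderiv {f : M → U} {x : M} (hf : MDifferentiableAt J I f x) (v : F) :
    thetaR I (f x) (mfderiv J I f x v) = rightLog I J f x v :=
  (tmap_comp_apply (mdifferentiableAt_mul_right (f x)⁻¹ (f x)) hf rfl v).symm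

theorem mdifferentiableAt_inv_mul {f : M → U} {x : M} (hf : MDifferentiableAt J I f x) (a : U) :
    MDifferentiableAt J I (fun z => a⁻¹ * f z) x :=
  (mdifferentiableAt_mul_left a⁻¹ (f x)).comp x hf

theorem mdifferentiableAt_mul_inv {f : M → U} {x : M} (hf : MDifferentiableAt J I f x) (a : U) :
    MDifferentiableAt J I (fun z => f z * a⁻¹) x :=
  (mdifferentiableAt_mul_right a⁻¹ (f x)).comp x hf

theorem leftLog_comp {f : N → U} {g : M → N} {x : M} {y : N} (hf : MDifferentiableAt J' I f y)
    (hg : MDifferentiableAt J J' g x) (hy : g x = y) (v : F) :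
    leftLog I J (fun z => f (g z)) x v = leftLog I J' f y (tmap J J' g x v) := by
  subst hy
  exact tmap_comp_apply (mdifferentiableAt_inv_mul hf (f (g x))) hg rfl v

theorem rightLog_comp {f : N → U} {g : M → N} {x : M} {y : N} (hf : MDifferentiableAt J' I f y)
    (hg : MDifferentiableAt J J' g x) (hy : g x = y) (v : F) :
    rightLog I J (fun z => f (g z)) x v = rightLog I J' f y (tmap J J' g x v) := by
  subst hy
  exact tmap_comp_apply (mdifferentiableAt_mul_inv hf (f (g x))) hg rfl v

theorem leftLog_conj {f : M → U} {x : M} (hf : MDifferentiableAt J I f x) (a : U) (v : F) :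
    leftLog I J (fun z => a * f z * a⁻¹) x v = adMap I a (leftLog I J f x v) := by
  have h : (fun z => (a * f x * a⁻¹)⁻¹ * (a * f z * a⁻¹)) =
      fun z => a * ((f x)⁻¹ * f z) * a⁻¹ := by
    funext z; group
  rw [leftLog, h]
  exact tmap_comp_apply (mdifferentiableAt_conj a 1) (mdifferentiableAt_inv_mul hf (f x))
    (by simp) v

theorem rightLog_eq_adMap {f : M → U} {x : M} (hf : MDifferentiableAt J I f x) (v : F) :
    rightLog I J f x v = adMap I (f x) (leftLog I J f x v) := by
  have h : (fun z => f z * (f x)⁻¹) = fun z => f x * ((f x)⁻¹ * f z) * (f x)⁻¹ := by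
    funext z; group
  rw [rightLog, h]
  exact tmap_comp_apply (mdifferentiableAt_conj (f x) 1) (mdifferentiableAt_inv_mul hf (f x))
    (by simp) v

/-- After left translation by `a⁻¹` the orbit map is `(a⁻¹ u a) u⁻¹`, a product of two maps equal to
`1` at `u = 1`, so the product rule applies. -/
theorem leftLog_orbit_conj (a : U) (X : E) :
    leftLog I I (fun u : U => u * a * u⁻¹) 1 X = adMap I a⁻¹ X - X := by
  have h : (fun u : U => ((1 : U) * a * (1 : U)⁻¹)⁻¹ * (u * a * u⁻¹)) =
      fun u => (a⁻¹ * u * a⁻¹⁻¹) * u⁻¹ := by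
    funext u; group
  rw [leftLog, h, tmap_mul_apply_of_eq_one (mdifferentiableAt_conj a⁻¹ 1)
    (mdifferentiableAt_inv 1) (by simp) (by simp),
    tmap_inv_apply_of_eq_one (f := fun u : U => u) mdifferentiableAt_id rfl, tmap_id, sub_eq_add_neg]
  rfl

theorem rightLog_orbit_conj (a : U) (X : E) :
    rightLog I I (fun u : U => u * a * u⁻¹) 1 X = X - adMap I a X := by
  have h : (fun u : U => (u * a * u⁻¹) * ((1 : U) * a * (1 : U)⁻¹)⁻¹) =
      fun u => u * (a * u * a⁻¹)⁻¹ := by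
    funext u; group
  rw [rightLog, h, tmap_mul_apply_of_eq_one (f := fun u : U => u)
    (h := fun u : U => (a * u * a⁻¹)⁻¹) mdifferentiableAt_id
    ((mdifferentiableAt_inv _).comp _ (mdifferentiableAt_conj a 1)) rfl (by simp),
    tmap_inv_apply_of_eq_one (mdifferentiableAt_conj a 1) (by simp), tmap_id, sub_eq_add_neg]
  rfl

theorem adMap_adMap_inv (a : U) (X : E) : adMap I a (adMap I a⁻¹ X) = X := by
  have h := tmap_comp_apply (mdifferentiableAt_conj (I := I) a 1)
    (mdifferentiableAt_conj (I := I) a⁻¹ 1) (by simp) X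
  have e : (fun z : U => a * (a⁻¹ * z * a⁻¹⁻¹) * a⁻¹) = fun z => z := by
    funext z; group
  rw [e, tmap_id] at h
  exact h.symm

/-- Inversion reverses products: the left quotient of `τ (f⁻¹)` is `τ` of the inverse of the right
quotient of `f`. -/
theorem leftLog_map_inv {f : M → U} {x : M} (hf : MDifferentiableAt J I f x) {τ : U ≃* U}
    (hτ : MDifferentiableAt I I (fun u : U => τ u) 1) (v : F) :
    leftLog I J (fun z => τ (f z)⁻¹) x v = -tmap I I (fun u : U => τ u) 1 (rightLog I J f x v) := by
  have h : (fun z => (τ (f x)⁻¹)⁻¹ * τ (f z)⁻¹) = fun z => τ (f z * (f x)⁻¹)⁻¹ := by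
    funext z; simp
  have hd := mdifferentiableAt_mul_inv hf (f x)
  rw [leftLog, h, tmap_comp_apply (f := fun z => (f z * (f x)⁻¹)⁻¹) hτ
    ((mdifferentiableAt_inv _).comp _ hd) (by simp), tmap_inv_apply_of_eq_one hd (by simp), map_neg]
  rfl

theorem rightLog_map_inv {f : M → U} {x : M} (hf : MDifferentiableAt J I f x) {τ : U ≃* U}
    (hτ : MDifferentiableAt I I (fun u : U => τ u) 1) (v : F) :
    rightLog I J (fun z => τ (f z)⁻¹) x v = -tmap I I (fun u : U => τ u) 1 (leftLog I J f x v) := by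
  have h : (fun z => τ (f z)⁻¹ * (τ (f x)⁻¹)⁻¹) = fun z => τ ((f x)⁻¹ * f z)⁻¹ := by
    funext z; simp
  have hd := mdifferentiableAt_inv_mul hf (f x)
  rw [rightLog, h, tmap_comp_apply (f := fun z => ((f x)⁻¹ * f z)⁻¹) hτ
    ((mdifferentiableAt_inv _).comp _ hd) (by simp), tmap_inv_apply_of_eq_one hd (by simp), map_neg]
  rfl

end LogarithmicDerivatives

/-! ### Evaluation of 2-forms and of the fusion form on pairs of vectors. -/

section Fusion

variable {E : Type*} [NormedAddCommGroup E] [NormedSpace ℝ E]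
  {H : Type*} [TopologicalSpace H] {I : ModelWithCorners ℝ E H}
  {U : Type*} [TopologicalSpace U] [ChartedSpace H U] [Group U] [LieGroup I ∞ U]
  {F₁ : Type*} [NormedAddCommGroup F₁] [NormedSpace ℝ F₁]
  {K₁ : Type*} [TopologicalSpace K₁] {J₁ : ModelWithCorners ℝ F₁ K₁}
  {M₁ : Type*} [TopologicalSpace M₁] [ChartedSpace K₁ M₁]
  {F₂ : Type*} [NormedAddCommGroup F₂] [NormedSpace ℝ F₂]
  {K₂ : Type*} [TopologicalSpace K₂] {J₂ : ModelWithCorners ℝ F₂ K₂}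
  {M₂ : Type*} [TopologicalSpace M₂] [ChartedSpace K₂ M₂]

/-- A pointwise `2`-form, as a function of two vectors of the model space. -/
def formAt (Ω : DiffForm J₁ M₁ 2) (x : M₁) : F₁ [⋀^Fin 2]→L[ℝ] ℝ := Ω x

/-- A bilinear form on the Lie algebra, regarded as a bilinear form on the model space. -/
def pairing (B : GroupLieAlgebra I U →L[ℝ] GroupLieAlgebra I U →L[ℝ] ℝ) : E →L[ℝ] E →L[ℝ] ℝ := B

theorem formAt_pullback {f : M₁ → M₂} (Ω : DiffForm J₂ M₂ 2) (x : M₁) (v w : F₁) :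
    formAt (pullback J₁ J₂ f Ω) x ![v, w] =
      formAt Ω (f x) ![tmap J₁ J₂ f x v, tmap J₁ J₂ f x w] := by
  have : tmap J₁ J₂ f x ∘ ![v, w] = ![tmap J₁ J₂ f x v, tmap J₁ J₂ f x w] := by
    funext i; fin_cases i <;> rfl
  rw [← this]; rfl

theorem formAt_fusionForm (B : GroupLieAlgebra I U →L[ℝ] GroupLieAlgebra I U →L[ℝ] ℝ)
    (Ω₁ : DiffForm J₁ M₁ 2) {μ₁ : M₁ → U} (Ω₂ : DiffForm J₂ M₂ 2) {μ₂ : M₂ → U} (p : M₁ × M₂)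
    (hμ₁ : MDifferentiableAt J₁ I μ₁ p.1) (hμ₂ : MDifferentiableAt J₂ I μ₂ p.2) (v w : F₁ × F₂) :
    formAt (fusionForm I J₁ J₂ B Ω₁ μ₁ Ω₂ μ₂) p ![v, w] =
      formAt Ω₁ p.1 ![v.1, w.1] + formAt Ω₂ p.2 ![v.2, w.2] +
      (1 / 2 : ℝ) * (pairing B (leftLog I J₁ μ₁ p.1 v.1) (rightLog I J₂ μ₂ p.2 w.2) -
        pairing B (leftLog I J₁ μ₁ p.1 w.1) (rightLog I J₂ μ₂ p.2 v.2)) := by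
  have h1 := formAt_pullback (J₁ := J₁.prod J₂) (f := (Prod.fst : M₁ × M₂ → M₁)) Ω₁ p v w
  have h2 := formAt_pullback (J₁ := J₁.prod J₂) (f := (Prod.snd : M₁ × M₂ → M₂)) Ω₂ p v w
  rw [tmap_fst] at h1
  rw [tmap_snd] at h2
  have hL (u : F₁ × F₂) : thetaL I (μ₁ p.1) (mfderiv J₁ I μ₁ p.1
      (mfderiv (J₁.prod J₂) J₁ Prod.fst p u)) = leftLog I J₁ μ₁ p.1 u.1 := by
    rw [mfderiv_fst]; exact thetaL_mfderiv hμ₁ u.1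
  have hR (u : F₁ × F₂) : thetaR I (μ₂ p.2) (mfderiv J₂ I μ₂ p.2
      (mfderiv (J₁.prod J₂) J₂ Prod.snd p u)) = rightLog I J₂ μ₂ p.2 u.2 := by
    rw [mfderiv_snd]; exact thetaR_mfderiv hμ₂ u.2
  refine congr_arg₂ (· + ·) (congr_arg₂ (· + ·) h1 h2) ?_
  rw [← hL, ← hL, ← hR, ← hR]
  rfl

theorem formAt_swap (Ω : DiffForm J₁ M₁ 2) (x : M₁) (v w : F₁) :
    formAt Ω x ![v, w] = -formAt Ω x ![w, v] := by
  have h := (formAt Ω x).map_swap ![w, v] (i := 0) (j := 1) (by decide)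
  have e : ![w, v] ∘ Equiv.swap (0 : Fin 2) 1 = ![v, w] := by
    funext i; fin_cases i <;> rfl
  rw [e] at h
  exact h

theorem formAt_add_left (Ω : DiffForm J₁ M₁ 2) (x : M₁) (v v' w : F₁) :
    formAt Ω x ![v + v', w] = formAt Ω x ![v, w] + formAt Ω x ![v', w] :=
  (formAt Ω x).vecCons_add _ _ _

theorem formAt_add_right (Ω : DiffForm J₁ M₁ 2) (x : M₁) (v w w' : F₁) :
    formAt Ω x ![v, w + w'] = formAt Ω x ![v, w] + formAt Ω x ![v, w'] := by
  rw [formAt_swap, formAt_add_left, formAt_swap Ω x v w, formAt_swap Ω x v w']; ring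

end Fusion

/-! ### Momentum maps, reversing involutions, and their effect on the fusion form. -/

section FusionInvolution

variable {E : Type*} [NormedAddCommGroup E] [NormedSpace ℝ E]
  {H : Type*} [TopologicalSpace H] {I : ModelWithCorners ℝ E H}
  {U : Type*} [TopologicalSpace U] [ChartedSpace H U] [Group U]
  {F₁ : Type*} [NormedAddCommGroup F₁] [NormedSpace ℝ F₁]
  {K₁ : Type*} [TopologicalSpace K₁] {J₁ : ModelWithCorners ℝ F₁ K₁}
  {M₁ : Type*} [TopologicalSpace M₁] [ChartedSpace K₁ M₁]
  [MulAction U M₁]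
  {F₂ : Type*} [NormedAddCommGroup F₂] [NormedSpace ℝ F₂]
  {K₂ : Type*} [TopologicalSpace K₂] {J₂ : ModelWithCorners ℝ F₂ K₂}
  {M₂ : Type*} [TopologicalSpace M₂] [ChartedSpace K₂ M₂]
  {B : GroupLieAlgebra I U →L[ℝ] GroupLieAlgebra I U →L[ℝ] ℝ}

theorem pairing_adMap (hB : IsAdInvariantEuclidean I B) (u : U) (X Y : E) :
    pairing B (adMap I u X) (adMap I u Y) = pairing B X Y :=
  hB.ad_invariant u X Y

theorem pairing_comm (hB : IsAdInvariantEuclidean I B) (X Y : E) :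
    pairing B X Y = pairing B Y X :=
  hB.symm X Y

theorem pairing_adMap_left [LieGroup I ∞ U] (hB : IsAdInvariantEuclidean I B) (u : U) (X Y : E) :
    pairing B (adMap I u X) Y = pairing B X (adMap I u⁻¹ Y) := by
  rw [← pairing_adMap hB u X, adMap_adMap_inv]

theorem mdifferentiableAt_orbit [ContMDiffSMul I J₁ ∞ U M₁] (x : M₁) :
    MDifferentiableAt I J₁ (fun u : U => u • x) 1 :=
  (contMDiff_id.smul (I := I) (I' := J₁) (n := ∞) contMDiff_const).mdifferentiableAt (by simp)

variable (I) in
theorem mdifferentiableAt_const_smul [ContMDiffSMul I J₁ ∞ U M₁] (u : U) (x : M₁) :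
    MDifferentiableAt J₁ J₁ (fun y : M₁ => u • y) x :=
  (ContMDiffSMul.contMDiff_const_smul (I := I) (n := ∞) u).mdifferentiableAt (by simp)

namespace IsQuasiHamiltonian

variable {Ω : DiffForm J₁ M₁ 2} {μ : M₁ → U}

theorem mdifferentiableAt (h : IsQuasiHamiltonian I J₁ B Ω μ) (x : M₁) :
    MDifferentiableAt J₁ I μ x :=
  h.smooth_momentum.mdifferentiableAt (by simp)

theorem formAt_orbit [LieGroup I ∞ U] (h : IsQuasiHamiltonian I J₁ B Ω μ) (x : M₁) (X : E) (v : F₁) :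
    formAt Ω x ![tmap I J₁ (fun u : U => u • x) 1 X, v] =
      (1 / 2 : ℝ) * (pairing B (leftLog I J₁ μ x v) X + pairing B (rightLog I J₁ μ x v) X) := by
  have e := h.momentum X x v
  rw [thetaL_mfderiv (h.mdifferentiableAt x), thetaR_mfderiv (h.mdifferentiableAt x)] at e
  refine e.trans ?_
  congr 1
  exact congr_arg (fun f : E →L[ℝ] ℝ => f X)
    (map_add (pairing B) (leftLog I J₁ μ x v) (rightLog I J₁ μ x v))

theorem formAt_const_smul (h : IsQuasiHamiltonian I J₁ B Ω μ) (u : U) (x : M₁) (v w : F₁) :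
    formAt Ω (u • x) ![tmap J₁ J₁ (fun y : M₁ => u • y) x v,
      tmap J₁ J₁ (fun y : M₁ => u • y) x w] = formAt Ω x ![v, w] := by
  rw [← formAt_pullback (f := fun y : M₁ => u • y), h.invariant]

variable [LieGroup I ∞ U] [ContMDiffSMul I J₁ ∞ U M₁]

/-- By equivariance, `μ` maps the orbit of `x` to the conjugation orbit of `μ x`. -/
theorem leftLog_orbit (h : IsQuasiHamiltonian I J₁ B Ω μ) (x : M₁) (X : E) :
    leftLog I J₁ μ x (tmap I J₁ (fun u : U => u • x) 1 X) = adMap I (μ x)⁻¹ X - X := by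
  rw [← leftLog_comp (h.mdifferentiableAt x) (mdifferentiableAt_orbit x) (one_smul U x)]
  simp only [h.equivariant]
  exact leftLog_orbit_conj _ _

theorem rightLog_orbit (h : IsQuasiHamiltonian I J₁ B Ω μ) (x : M₁) (X : E) :
    rightLog I J₁ μ x (tmap I J₁ (fun u : U => u • x) 1 X) = X - adMap I (μ x) X := by
  rw [← rightLog_comp (h.mdifferentiableAt x) (mdifferentiableAt_orbit x) (one_smul U x)]
  simp only [h.equivariant]
  exact rightLog_orbit_conj _ _

theorem leftLog_const_smul (h : IsQuasiHamiltonian I J₁ B Ω μ) (u : U) (x : M₁) (v : F₁) :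
    leftLog I J₁ μ (u • x) (tmap J₁ J₁ (fun y : M₁ => u • y) x v) =
      adMap I u (leftLog I J₁ μ x v) := by
  rw [← leftLog_comp (h.mdifferentiableAt (u • x)) (mdifferentiableAt_const_smul I u x) rfl]
  simp only [h.equivariant]
  exact leftLog_conj (h.mdifferentiableAt x) u v

/-- The value of the form on vectors modified by vectors tangent to the orbit. -/
theorem formAt_add_orbit (hB : IsAdInvariantEuclidean I B) (h : IsQuasiHamiltonian I J₁ B Ω μ)
    (x : M₁) (X Y : E) (v w : F₁) :
    formAt Ω x ![tmap I J₁ (fun u : U => u • x) 1 X + v,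
        tmap I J₁ (fun u : U => u • x) 1 Y + w] +
      (1 / 2 : ℝ) * (pairing B (leftLog I J₁ μ x (tmap I J₁ (fun u : U => u • x) 1 X + v)) Y -
        pairing B (leftLog I J₁ μ x (tmap I J₁ (fun u : U => u • x) 1 Y + w)) X) =
      formAt Ω x ![v, w] + (1 / 2 : ℝ) * (pairing B (rightLog I J₁ μ x w) X -
        pairing B (rightLog I J₁ μ x v) Y) := by
  rw [formAt_add_left, formAt_add_right, formAt_add_right, h.formAt_orbit, h.formAt_orbit,
    formAt_swap Ω x v, h.formAt_orbit]
  simp only [map_add, map_sub, add_apply, sub_apply, h.leftLog_orbit, h.rightLog_orbit]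
  -- The terms bilinear in `X` and `Y` cancel because the adjoint of `Ad (μ x)` for `B` is `Ad (μ
  -- x)⁻¹`.
  rw [pairing_adMap_left hB (μ x) Y X, pairing_comm hB Y (adMap I (μ x)⁻¹ X), pairing_comm hB Y X]
  ring

end IsQuasiHamiltonian

namespace IsReversingInvolution

variable {U : Type*} [Group U] [MulAction U M₁] {Ω : DiffForm J₁ M₁ 2} {τ : U ≃* U}
  {μ : M₁ → U} {β : M₁ → M₁}

theorem mdifferentiableAt (h : IsReversingInvolution J₁ τ Ω μ β)
    (x : M₁) : MDifferentiableAt J₁ J₁ β x :=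
  h.smooth.mdifferentiableAt (by simp)

theorem formAt_tmap (h : IsReversingInvolution J₁ τ Ω μ β) (x : M₁)
    (v w : F₁) :
    formAt Ω (β x) ![tmap J₁ J₁ β x v, tmap J₁ J₁ β x w] = -formAt Ω x ![v, w] := by
  rw [← formAt_pullback, h.reverses]
  rfl

variable [TopologicalSpace U] [ChartedSpace H U] [LieGroup I ∞ U]

theorem leftLog_tmap (h : IsReversingInvolution J₁ τ Ω μ β)
    (hμ : ∀ x, MDifferentiableAt J₁ I μ x) (hτ : MDifferentiableAt I I (fun u : U => τ u) 1)
    (x : M₁) (v : F₁) :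
    leftLog I J₁ μ (β x) (tmap J₁ J₁ β x v) =
      -tmap I I (fun u : U => τ u) 1 (rightLog I J₁ μ x v) := by
  rw [← leftLog_comp (hμ (β x)) (h.mdifferentiableAt x) rfl]
  simp only [h.momentum]
  exact leftLog_map_inv (hμ x) hτ v

theorem rightLog_tmap (h : IsReversingInvolution J₁ τ Ω μ β)
    (hμ : ∀ x, MDifferentiableAt J₁ I μ x) (hτ : MDifferentiableAt I I (fun u : U => τ u) 1)
    (x : M₁) (v : F₁) :
    rightLog I J₁ μ (β x) (tmap J₁ J₁ β x v) =
      -tmap I I (fun u : U => τ u) 1 (leftLog I J₁ μ x v) := by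
  rw [← rightLog_comp (hμ (β x)) (h.mdifferentiableAt x) rfl]
  simp only [h.momentum]
  exact rightLog_map_inv (hμ x) hτ v

end IsReversingInvolution

variable [LieGroup I ∞ U] [ContMDiffSMul I J₁ ∞ U M₁]

/-- Factoring out the fixed element `g = μ₂ (β₂ p.2)` leaves a group factor equal to `1` at `p`; its
derivative is the left logarithmic derivative, which enters through the fundamental field at `β₁
p.1`. -/
theorem tmap_fusionInvolution {μ₂ : M₂ → U} {β₁ : M₁ → M₁} {β₂ : M₂ → M₂} (p : M₁ × M₂)
    (hμ₂ : MDifferentiableAt J₂ I μ₂ (β₂ p.2)) (hβ₁ : MDifferentiableAt J₁ J₁ β₁ p.1)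
    (hβ₂ : MDifferentiableAt J₂ J₂ β₂ p.2) (v : F₁ × F₂) :
    tmap (J₁.prod J₂) (J₁.prod J₂) (fusionInvolution μ₂ β₁ β₂) p v =
      (tmap J₁ J₁ (fun y : M₁ => μ₂ (β₂ p.2) • y) (β₁ p.1)
        (tmap I J₁ (fun u : U => u • β₁ p.1) 1
          (leftLog I J₂ μ₂ (β₂ p.2) (tmap J₂ J₂ β₂ p.2 v.2)) + tmap J₁ J₁ β₁ p.1 v.1),
        tmap J₂ J₂ β₂ p.2 v.2) := by
  set g := μ₂ (β₂ p.2) with hg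
  have hfst : MDifferentiableAt (J₁.prod J₂) J₁ (Prod.fst : M₁ × M₂ → M₁) p := mdifferentiableAt_fst
  have hsnd : MDifferentiableAt (J₁.prod J₂) J₂ (Prod.snd : M₁ × M₂ → M₂) p := mdifferentiableAt_snd
  have hb₁ : MDifferentiableAt (J₁.prod J₂) J₁ (fun q : M₁ × M₂ => β₁ q.1) p := hβ₁.comp p hfst
  have hb₂ : MDifferentiableAt (J₁.prod J₂) J₂ (fun q : M₁ × M₂ => β₂ q.2) p := hβ₂.comp p hsnd
  have hlog : MDifferentiableAt J₂ I (fun z => g⁻¹ * μ₂ z) (β₂ p.2) :=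
    mdifferentiableAt_inv_mul hμ₂ g
  have hm : MDifferentiableAt (J₁.prod J₂) I (fun q : M₁ × M₂ => g⁻¹ * μ₂ (β₂ q.2)) p :=
    MDifferentiableAt.comp (g := fun z => g⁻¹ * μ₂ z) p hlog hb₂
  have hact : MDifferentiableAt (J₁.prod J₂) J₁
      (fun q : M₁ × M₂ => (g⁻¹ * μ₂ (β₂ q.2)) • β₁ q.1) p :=
    MDifferentiableAt.comp (I' := I.prod J₁) p (g := fun q : U × M₁ => q.1 • q.2)
      ((contMDiff_smul (n := ∞)).mdifferentiableAt (by simp)) (hm.prodMk hb₁)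
  have h1 : (g⁻¹ * μ₂ (β₂ p.2)) = 1 := by simp [hg]
  have e : fusionInvolution μ₂ β₁ β₂ =
      fun q : M₁ × M₂ => (g • ((g⁻¹ * μ₂ (β₂ q.2)) • β₁ q.1), β₂ q.2) := by
    funext q; simp [fusionInvolution, smul_smul]
  rw [e, tmap_prodMk (f := fun q : M₁ × M₂ => g • ((g⁻¹ * μ₂ (β₂ q.2)) • β₁ q.1))
    ((mdifferentiableAt_const_smul I g _).comp p hact) hb₂]
  refine Prod.ext ?_ ?_
  · change tmap (J₁.prod J₂) J₁ (fun q : M₁ × M₂ => g • ((g⁻¹ * μ₂ (β₂ q.2)) • β₁ q.1)) p v = _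
    rw [tmap_comp_apply (mdifferentiableAt_const_smul I g (β₁ p.1)) hact (by simp [h1]),
      tmap_smul_apply_of_eq_one hm hb₁ h1 rfl,
      tmap_comp_apply (f := fun q : M₁ × M₂ => β₂ q.2) hlog hb₂ rfl,
      tmap_comp_apply hβ₁ hfst rfl, tmap_comp_apply hβ₂ hsnd rfl, tmap_fst, tmap_snd]
    rfl
  · change tmap (J₁.prod J₂) J₂ (fun q : M₁ × M₂ => β₂ q.2) p v = _
    rw [tmap_comp_apply hβ₂ hsnd rfl, tmap_snd]
    rfl

variable {Ω₁ : DiffForm J₁ M₁ 2} {μ₁ : M₁ → U} {Ω₂ : DiffForm J₂ M₂ 2} {μ₂ : M₂ → U}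
  [MulAction U M₂] {τ : U ≃* U} {β₁ : M₁ → M₁} {β₂ : M₂ → M₂}

theorem formAt_fusionForm_tmap_fusionInvolution (hB : IsAdInvariantEuclidean I B)
    (h₁ : IsQuasiHamiltonian I J₁ B Ω₁ μ₁)
    (hτ : IsInvolutiveAutomorphism I B τ) (hβ₁ : IsReversingInvolution J₁ τ Ω₁ μ₁ β₁)
    (hβ₂ : IsReversingInvolution J₂ τ Ω₂ μ₂ β₂) (hμ₂ : ∀ x, MDifferentiableAt J₂ I μ₂ x)
    (p : M₁ × M₂) (v w : F₁ × F₂) :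
    formAt (fusionForm I J₁ J₂ B Ω₁ μ₁ Ω₂ μ₂) (fusionInvolution μ₂ β₁ β₂ p)
      ![tmap (J₁.prod J₂) (J₁.prod J₂) (fusionInvolution μ₂ β₁ β₂) p v,
        tmap (J₁.prod J₂) (J₁.prod J₂) (fusionInvolution μ₂ β₁ β₂) p w] =
      -formAt (fusionForm I J₁ J₂ B Ω₁ μ₁ Ω₂ μ₂) p ![v, w] := by
  have hτ' : MDifferentiableAt I I (fun u : U => τ u) 1 := hτ.smooth.mdifferentiableAt (by simp)
  have hiso (X Y : E) : pairing B (tmap I I (fun u : U => τ u) 1 X)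
      (tmap I I (fun u : U => τ u) 1 Y) = pairing B X Y := hτ.isometry X Y
  rw [formAt_fusionForm B Ω₁ Ω₂ _ (h₁.mdifferentiableAt _) (hμ₂ _),
    formAt_fusionForm B Ω₁ Ω₂ _ (h₁.mdifferentiableAt _) (hμ₂ _),
    tmap_fusionInvolution p (hμ₂ _) (hβ₁.mdifferentiableAt _) (hβ₂.mdifferentiableAt _),
    tmap_fusionInvolution p (hμ₂ _) (hβ₁.mdifferentiableAt _) (hβ₂.mdifferentiableAt _)]
  simp only [fusionInvolution]
  -- First remove the common translation by `g` and the common `Ad g`; `add_right_comm` then sets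
  -- the `Ω₁` term next to the fusion term, so that the orbit directions can be absorbed.
  rw [h₁.formAt_const_smul, h₁.leftLog_const_smul, h₁.leftLog_const_smul,
    rightLog_eq_adMap (hμ₂ _), rightLog_eq_adMap (hμ₂ _), pairing_adMap hB, pairing_adMap hB,
    add_right_comm, h₁.formAt_add_orbit hB, hβ₁.formAt_tmap, hβ₂.formAt_tmap,
    hβ₁.rightLog_tmap h₁.mdifferentiableAt hτ', hβ₁.rightLog_tmap h₁.mdifferentiableAt hτ',
    hβ₂.leftLog_tmap hμ₂ hτ', hβ₂.leftLog_tmap hμ₂ hτ']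
  -- Both arguments of each pairing carry a factor `-dτ`: the signs cancel and the isometry removes
  -- `dτ`.
  simp only [map_neg, neg_apply, neg_neg, hiso]
  ring

end FusionInvolution

end QuasiHam

end

/-! ### The fusion involution. -/

theorem lemma6p12
    {E : Type*} [NormedAddCommGroup E] [NormedSpace ℝ E] [FiniteDimensional ℝ E]
    {H : Type*} [TopologicalSpace H] (I : ModelWithCorners ℝ E H)
    {U : Type*} [TopologicalSpace U] [ChartedSpace H U] [Group U] [LieGroup I ∞ U]
    [BoundarylessManifold I U] [T2Space U] [CompactSpace U] [ConnectedSpace U]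
    {F₁ : Type*} [NormedAddCommGroup F₁] [NormedSpace ℝ F₁] [FiniteDimensional ℝ F₁]
    {K₁ : Type*} [TopologicalSpace K₁] (J₁ : ModelWithCorners ℝ F₁ K₁)
    {M₁ : Type*} [TopologicalSpace M₁] [ChartedSpace K₁ M₁] [IsManifold J₁ ∞ M₁]
    [BoundarylessManifold J₁ M₁] [MulAction U M₁] [ContMDiffSMul I J₁ ∞ U M₁]
    {F₂ : Type*} [NormedAddCommGroup F₂] [NormedSpace ℝ F₂] [FiniteDimensional ℝ F₂]
    {K₂ : Type*} [TopologicalSpace K₂] (J₂ : ModelWithCorners ℝ F₂ K₂)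
    {M₂ : Type*} [TopologicalSpace M₂] [ChartedSpace K₂ M₂] [IsManifold J₂ ∞ M₂]
    [BoundarylessManifold J₂ M₂] [MulAction U M₂] [ContMDiffSMul I J₂ ∞ U M₂]
    (B : GroupLieAlgebra I U →L[ℝ] GroupLieAlgebra I U →L[ℝ] ℝ)
    (hB : QuasiHam.IsAdInvariantEuclidean I B)
    (Ω₁ : QuasiHam.DiffForm J₁ M₁ 2) (μ₁ : M₁ → U)
    (h₁ : QuasiHam.IsQuasiHamiltonian I J₁ B Ω₁ μ₁)
    (Ω₂ : QuasiHam.DiffForm J₂ M₂ 2) (μ₂ : M₂ → U)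
    (h₂ : QuasiHam.IsQuasiHamiltonian I J₂ B Ω₂ μ₂)
    (τ : U ≃* U) (hτ : QuasiHam.IsInvolutiveAutomorphism I B τ)
    (β₁ : M₁ → M₁) (hβ₁ : QuasiHam.IsReversingInvolution J₁ τ Ω₁ μ₁ β₁)
    (β₂ : M₂ → M₂) (hβ₂ : QuasiHam.IsReversingInvolution J₂ τ Ω₂ μ₂ β₂) :
    QuasiHam.IsReversingInvolution (J₁.prod J₂) τ
      (QuasiHam.fusionForm I J₁ J₂ B Ω₁ μ₁ Ω₂ μ₂)
      (QuasiHam.fusionMomentum μ₁ μ₂)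
      (QuasiHam.fusionInvolution μ₂ β₁ β₂) := by
  refine ⟨?_, fun p => ?_, ?_, fun u p => ?_, fun p => ?_⟩
  · exact (((h₂.smooth_momentum.comp hβ₂.smooth).comp contMDiff_snd).smul
      (hβ₁.smooth.comp contMDiff_fst)).prodMk (hβ₂.smooth.comp contMDiff_snd)
  · refine Prod.ext ?_ (hβ₂.involutive _)
    -- The element acting on `x₁` is `μ₂ x₂ * τ (μ₂ (β₂ x₂))`, and the second factor is `(μ₂ x₂)⁻¹`.
    simp [QuasiHam.fusionInvolution, hβ₁.action, hβ₂.momentum, hβ₁.involutive, hβ₂.involutive,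
      hτ.involutive, smul_smul]
  · funext p
    refine ContinuousAlternatingMap.ext fun v => ?_
    have hv : v = ![v 0, v 1] := by funext i; fin_cases i <;> rfl
    rw [hv]
    exact (QuasiHam.formAt_pullback (J₁ := J₁.prod J₂) (J₂ := J₁.prod J₂) _ p (v 0) (v 1)).trans
      (QuasiHam.formAt_fusionForm_tmap_fusionInvolution hB h₁ hτ hβ₁ hβ₂
        (fun x => h₂.mdifferentiableAt x) p (v 0) (v 1))
  · refine Prod.ext ?_ (hβ₂.action u p.2)
    -- Conjugating `μ₂ (β₂ x₂)` by `τ u` yields a trailing `(τ u)⁻¹`, which cancels the `τ u` coming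
    -- from `β₁`.
    simp [QuasiHam.fusionInvolution, hβ₁.action, hβ₂.action, h₂.equivariant, smul_smul]
  -- With `g = μ₂ (β₂ x₂)`, the product `(g μ₁(β₁ x₁) g⁻¹) g` collapses to `g μ₁(β₁ x₁)`, the order
  -- in which `τ⁻` reverses `μ₁ μ₂`.
  · simp [QuasiHam.fusionInvolution, QuasiHam.fusionMomentum, h₁.equivariant, hβ₁.momentum,
      hβ₂.momentum]
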